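/- **Setting.** Let $\mathsf W,\mathsf X,\mathsf Y$ be standard Borel spaces, $P_W$ a probability distribution on $\mathsf W$, $P_{X|W}$ a probability kernel from $\mathsf W$ to $\mathsf X$, $K_{Y|X,W}$ a probability kernel from $\mathsf W\times\mathsf X$ to $\mathsf Y$, and put $P_{Z|W}=P_{X|W}K_{Y|X,W}$, a kernel from $\mathsf W$ to $\mathsf Z=\mathsf X\times\mathsf Y$. For $n\ge 0$ let $W$, the data $Z^n=(Z_1,\dots,Z_n)$ with $Z_i=(X_i,Y_i)$, and the fresh pair $Z=(X,Y)$ have joint distribution $$P_{W,Z^n,Z}=P_W\Big(\prod_{i=1}^n P_{Z_i|W}\Big)P_{Z|W},\qquad P_{Z_i|W}=P_{Z|W}.$$ Let $\mu$ be a $\sigma$-finite measure on $\mathsf Y$. Predictions are probability densities $q$ on $\mathsf Y$ with respect to $\mu$, and the log loss is $\ell(y,q)=-\log q(y)\in[-\infty,\infty]$. The Bayes risk of predicting $Y$ from an observed random element $V$ is $$R_{\log}(Y|V)=\inf_\psi \mathbb E[-\log \psi(V)(Y)]\in[-\infty,\infty],$$ where the infimum is over all decision rules $\psi$, assigning to each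 value of $V$ a density, for which $(v,y)\mapsto-\log\psi(v)(y)$ is measurable and the expectation is defined (i.e. the positive part or the negative part is integrable). The minimum excess risk is $${\rm MER}_{\log}=R_{\log}(Y|X,Z^n)-R_{\log}(Y|X,W),$$ which is assumed to be well defined, i.e. the two terms are not both $+\infty$ and not both $-\infty$. **Theorem.** Let $W'$ be a sample from the posterior distribution $P_{W|X,Z^n}$, conditionally independent of everything else given $(X,Z^n)$. Then $${\rm MER}_{\log}\le \mathbb E\big[D_{\rm KL}(K_{Y|X,W}\,\|\,K_{Y|X,W'})\big],$$ where the expectation is taken with respect to the joint distribution of $(W,W',X)$ and both sides may be infinite. -/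

import Mathlib

open MeasureTheory ProbabilityTheory InformationTheory
open scoped ENNReal

namespace BayesLearning

noncomputable section

/-! ### Expected loss, Bayes risk -/

/-- The expectation of an extended-real function is defined when its positive part or its negative
part has a finite integral. -/
def ExpectationDefined {Ω : Type*} [MeasurableSpace Ω] (P : Measure Ω) (f : Ω → EReal) : Prop :=
  ∫⁻ ω, (f ω).toENNReal ∂P ≠ ∞ ∨ ∫⁻ ω, (-f ω).toENNReal ∂P ≠ ∞

/-- The expectation of an extended-real function: integral of the positive part minus integral of
the negative part. It is meaningful when `ExpectationDefined P f` holds. -/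
def expectation {Ω : Type*} [MeasurableSpace Ω] (P : Measure Ω) (f : Ω → EReal) : EReal :=
  ((∫⁻ ω, (f ω).toENNReal ∂P : ℝ≥0∞) : EReal) - ((∫⁻ ω, (-f ω).toENNReal ∂P : ℝ≥0∞) : EReal)

/-- The Bayes risk `R_ℓ(Y | V)`: the infimum of `E[ℓ(Y, ψ(V))]` over all decision rules `ψ` with
values in the action space `A` for which the loss is measurable and its expectation is defined. -/
def bayesRisk {Ω 𝓥 𝓨 A : Type*} [MeasurableSpace Ω] [MeasurableSpace 𝓥] [MeasurableSpace 𝓨]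
    (ℓ : 𝓨 → A → EReal) (P : Measure Ω) (Y : Ω → 𝓨) (V : Ω → 𝓥) : EReal :=
  ⨅ (ψ : 𝓥 → A) (_ : Measurable fun p : 𝓥 × 𝓨 => ℓ p.2 (ψ p.1))
    (_ : ExpectationDefined P fun ω => ℓ (Y ω) (ψ (V ω))),
    expectation P fun ω => ℓ (Y ω) (ψ (V ω))

/-- The action space of soft predictions: probability densities on `𝓨` with respect to `μ`. -/
abbrev Density {𝓨 : Type*} [MeasurableSpace 𝓨] (μ : Measure 𝓨) : Type _ :=
  {q : 𝓨 → ℝ≥0∞ // Measurable q ∧ ∫⁻ y, q y ∂μ = 1}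

/-- The log loss `ℓ(y, q) = -log q(y)`. -/
def logLoss {𝓨 : Type*} [MeasurableSpace 𝓨] (μ : Measure 𝓨) (y : 𝓨) (q : Density μ) : EReal :=
  -ENNReal.log (q.1 y)

/-! ### The generative model -/

/-- The kernel `w ↦ κ(w)^{⊗ n}`: `n` conditionally i.i.d. samples from `κ(w)`. -/
def iidKernel {𝓦 𝓩 : Type*} [MeasurableSpace 𝓦] [MeasurableSpace 𝓩] (n : ℕ)
    (κ : Kernel 𝓦 𝓩) [IsMarkovKernel κ] : Kernel 𝓦 (Fin n → 𝓩) where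
  toFun w := Measure.pi fun _ => κ w
  measurable' := by
    refine Measurable.measure_of_isPiSystem_of_isProbabilityMeasure
      (generateFrom_pi (α := fun _ : Fin n => 𝓩)).symm isPiSystem_pi ?_
    rintro _ ⟨s, hs, rfl⟩
    simp only [Measure.pi_pi]
    exact Finset.measurable_prod _ fun i _ => κ.measurable_coe (hs i (Set.mem_univ i))

instance {𝓦 𝓩 : Type*} [MeasurableSpace 𝓦] [MeasurableSpace 𝓩] (n : ℕ)
    (κ : Kernel 𝓦 𝓩) [IsMarkovKernel κ] : IsMarkovKernel (iidKernel n κ) :=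
  ⟨fun w => inferInstanceAs (IsProbabilityMeasure (Measure.pi fun _ : Fin n => κ w))⟩

/-- Outcomes `(w, z^n, (x, y))`: the model parameters, the data set `z^n` of `n` labelled samples
`z_i = (x_i, y_i)`, and the fresh pair `z = (x, y)`. -/
abbrev Outcome (𝓦 𝓧 𝓨 : Type*) (n : ℕ) : Type _ := 𝓦 × (Fin n → 𝓧 × 𝓨) × (𝓧 × 𝓨)

namespace Outcome

variable {𝓦 𝓧 𝓨 : Type*} {n : ℕ}

/-- The model parameters `W`. -/
def W (ω : Outcome 𝓦 𝓧 𝓨 n) : 𝓦 := ω.1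

/-- The data set `Z^n`. -/
def Zn (ω : Outcome 𝓦 𝓧 𝓨 n) : Fin n → 𝓧 × 𝓨 := ω.2.1

/-- The fresh observation `X`. -/
def X (ω : Outcome 𝓦 𝓧 𝓨 n) : 𝓧 := ω.2.2.1

/-- The quantity `Y` to be predicted. -/
def Y (ω : Outcome 𝓦 𝓧 𝓨 n) : 𝓨 := ω.2.2.2

/-- What the learner sees: `(X, Z^n)`. -/
def observed (ω : Outcome 𝓦 𝓧 𝓨 n) : 𝓧 × (Fin n → 𝓧 × 𝓨) := (ω.X, ω.Zn)

/-- What the omniscient predictor sees: `(X, W)`. -/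
def omniscient (ω : Outcome 𝓦 𝓧 𝓨 n) : 𝓧 × 𝓦 := (ω.X, ω.W)

theorem measurable_observed [MeasurableSpace 𝓦] [MeasurableSpace 𝓧] [MeasurableSpace 𝓨] :
    Measurable (observed : Outcome 𝓦 𝓧 𝓨 n → _) := by
  unfold observed X Zn; fun_prop

end Outcome

/-- The joint distribution `P_{W, Z^n, Z} = P_W (∏ i, P_{Z_i | W}) P_{Z | W}`. -/
def jointLaw {𝓦 𝓧 𝓨 : Type*} [MeasurableSpace 𝓦] [MeasurableSpace 𝓧] [MeasurableSpace 𝓨] (n : ℕ)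
    (PW : Measure 𝓦) (PZ : Kernel 𝓦 (𝓧 × 𝓨)) [IsMarkovKernel PZ] :
    Measure (Outcome 𝓦 𝓧 𝓨 n) :=
  PW ⊗ₘ (iidKernel n PZ ×ₖ PZ)

instance {𝓦 𝓧 𝓨 : Type*} [MeasurableSpace 𝓦] [MeasurableSpace 𝓧] [MeasurableSpace 𝓨] (n : ℕ)
    (PW : Measure 𝓦) [IsProbabilityMeasure PW] (PZ : Kernel 𝓦 (𝓧 × 𝓨)) [IsMarkovKernel PZ] :
    IsProbabilityMeasure (jointLaw n PW PZ) :=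
  inferInstanceAs (IsProbabilityMeasure (PW ⊗ₘ (iidKernel n PZ ×ₖ PZ)))

/-- The Bayes risk `R_ℓ(Y | X, Z^n)` of learning. -/
def learningRisk {𝓦 𝓧 𝓨 A : Type*} [MeasurableSpace 𝓦] [MeasurableSpace 𝓧] [MeasurableSpace 𝓨]
    (ℓ : 𝓨 → A → EReal) (n : ℕ) (PW : Measure 𝓦) (PZ : Kernel 𝓦 (𝓧 × 𝓨)) [IsMarkovKernel PZ] :
    EReal :=
  bayesRisk ℓ (jointLaw n PW PZ) Outcome.Y Outcome.observed

/-- The fundamental limit `R_ℓ(Y | X, W)` of the Bayes risk. -/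
def omniscientRisk {𝓦 𝓧 𝓨 A : Type*} [MeasurableSpace 𝓦] [MeasurableSpace 𝓧] [MeasurableSpace 𝓨]
    (ℓ : 𝓨 → A → EReal) (n : ℕ) (PW : Measure 𝓦) (PZ : Kernel 𝓦 (𝓧 × 𝓨)) [IsMarkovKernel PZ] :
    EReal :=
  bayesRisk ℓ (jointLaw n PW PZ) Outcome.Y Outcome.omniscient

/-- The minimum excess risk `MER_ℓ = R_ℓ(Y | X, Z^n) - R_ℓ(Y | X, W)`. -/
def MER {𝓦 𝓧 𝓨 A : Type*} [MeasurableSpace 𝓦] [MeasurableSpace 𝓧] [MeasurableSpace 𝓨]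
    (ℓ : 𝓨 → A → EReal) (n : ℕ) (PW : Measure 𝓦) (PZ : Kernel 𝓦 (𝓧 × 𝓨)) [IsMarkovKernel PZ] :
    EReal :=
  learningRisk ℓ n PW PZ - omniscientRisk ℓ n PW PZ

/-- The difference defining `MER_ℓ` is not of the form `∞ - ∞` or `(-∞) - (-∞)`. -/
def MERDefined {𝓦 𝓧 𝓨 A : Type*} [MeasurableSpace 𝓦] [MeasurableSpace 𝓧] [MeasurableSpace 𝓨]
    (ℓ : 𝓨 → A → EReal) (n : ℕ) (PW : Measure 𝓦) (PZ : Kernel 𝓦 (𝓧 × 𝓨)) [IsMarkovKernel PZ] :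
    Prop :=
  ¬ (learningRisk ℓ n PW PZ = ⊤ ∧ omniscientRisk ℓ n PW PZ = ⊤) ∧
    ¬ (learningRisk ℓ n PW PZ = ⊥ ∧ omniscientRisk ℓ n PW PZ = ⊥)

/-! ### Posterior sampling -/

/-- The posterior distribution `P_{W | X, Z^n}`. -/
def posteriorKernel {𝓦 𝓧 𝓨 : Type*} [MeasurableSpace 𝓦] [StandardBorelSpace 𝓦] [Nonempty 𝓦]
    [MeasurableSpace 𝓧] [MeasurableSpace 𝓨] (n : ℕ)
    (PW : Measure 𝓦) [IsProbabilityMeasure PW] (PZ : Kernel 𝓦 (𝓧 × 𝓨)) [IsMarkovKernel PZ] :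
    Kernel (𝓧 × (Fin n → 𝓧 × 𝓨)) 𝓦 :=
  condDistrib Outcome.W Outcome.observed (jointLaw n PW PZ)

/-- The joint distribution of `((W, Z^n, (X, Y)), W')`, where `W'` is drawn from the posterior
`P_{W | X, Z^n}`, conditionally independently of everything else given `(X, Z^n)`. -/
def posteriorSampleLaw {𝓦 𝓧 𝓨 : Type*} [MeasurableSpace 𝓦] [StandardBorelSpace 𝓦] [Nonempty 𝓦]
    [MeasurableSpace 𝓧] [MeasurableSpace 𝓨] (n : ℕ)
    (PW : Measure 𝓦) [IsProbabilityMeasure PW] (PZ : Kernel 𝓦 (𝓧 × 𝓨)) [IsMarkovKernel PZ] :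
    Measure (Outcome 𝓦 𝓧 𝓨 n × 𝓦) :=
  jointLaw n PW PZ ⊗ₘ
    (posteriorKernel n PW PZ).comap Outcome.observed Outcome.measurable_observed

end

end BayesLearning

namespace BayesLearning

/-! Fix an omniscient rule with density `s`. The learner answers with the mixture `q` of the
conditional densities `p` of `Y` given `(X, W')`, averaged over `W'`. If `k` and `k'` are the
densities of `Y` under `W` and `W'`, and `t` is the density of the first law with respect to the
second, then `k = t * k'`, and `log x ≤ x - 1` used twice gives `-log q ≤ -log s + log t + (s/k - 1)
+ (p/q - 1)`, which is `neg_log_le_add`. In expectation `log t` yields the relative entropy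
(`integral_log_rnDeriv_compProd`), and the two brackets contribute at most zero: `s/k` integrates to
at most `∫ s dμ = 1`, while averaging `p/q` over `W'` gives at most `q/q ≤ 1`. Of the law of `W'`
only its conditional independence given `(X, Z^n)` is used, so the comparison holds for every Markov
kernel `π`.

Two points need care. `K` may have a part singular to `μ`, on which an omniscient density can be
infinite and its loss `-∞`; so `p` is made infinite on the `μ`-null carrier of the singular part,
and `q` inherits this where needed. Also, risks may be infinite, so expectations are compared
through positive and negative parts (`expectation_le_add`). -/

/-! ### Jointly measurable densities of a kernel -/

/-- Jointly measurable Lebesgue decomposition of a finite kernel with respect to a σ-finite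
measure: `k` is the density of the absolutely continuous part, and the null set `N` carries the
singular part. -/
theorem exists_measurable_density {α 𝓨 : Type*} [MeasurableSpace α] [MeasurableSpace 𝓨]
    [MeasurableSpace.CountableOrCountablyGenerated α 𝓨] (K : Kernel α 𝓨) [IsFiniteKernel K]
    (μ : Measure 𝓨) [SigmaFinite μ] :
    ∃ (k : α → 𝓨 → ℝ≥0∞) (N : Set (α × 𝓨)), Measurable (Function.uncurry k) ∧ MeasurableSet N ∧
      ∀ a, μ (Prod.mk a ⁻¹' N) = 0 ∧
        (K a).restrict (Prod.mk a ⁻¹' N)ᶜ = μ.withDensity (k a) := by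
  -- Kernel derivatives are taken against a finite kernel. A weight `g > 0` of finite integral gives
  -- a finite `ν` with the null sets of `μ`, and `g` is multiplied back into the density.
  obtain ⟨g, hg0, hgm, hg⟩ := exists_pos_lintegral_lt_of_sigmaFinite μ one_ne_zero
  set ν : Measure 𝓨 := μ.withDensity fun y => (g y : ℝ≥0∞) with hν
  have hgm' : Measurable fun y => (g y : ℝ≥0∞) := hgm.coe_nnreal_ennreal
  have : IsFiniteMeasure ν := isFiniteMeasure_withDensity (hg.trans ENNReal.one_lt_top).ne
  have hμν : μ ≪ ν := withDensity_absolutelyContinuous' hgm'.aemeasurable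
    (.of_forall fun y => by simpa using (hg0 y).ne')
  let η : Kernel α 𝓨 := Kernel.const α ν
  have hr (a : α) : Measurable (Kernel.rnDeriv K η a) := Kernel.measurable_rnDeriv_right K η a
  refine ⟨fun a y => g y * Kernel.rnDeriv K η a y, Kernel.mutuallySingularSet K η,
    (hgm'.comp measurable_snd).mul (Kernel.measurable_rnDeriv K η),
    Kernel.measurableSet_mutuallySingularSet K η, fun a => ?_⟩
  have hs : Prod.mk a ⁻¹' Kernel.mutuallySingularSet K η = Kernel.mutuallySingularSetSlice K η a :=
    rfl
  rw [hs]
  have hms := Kernel.measurableSet_mutuallySingularSetSlice K η a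
  refine ⟨hμν (Kernel.measure_mutuallySingularSetSlice K η a), ?_⟩
  have hw : μ.withDensity (fun y => (g y : ℝ≥0∞) * Kernel.rnDeriv K η a y)
      = Kernel.withDensity η (Kernel.rnDeriv K η) a := by
    rw [Kernel.withDensity_apply η (Kernel.measurable_rnDeriv K η)]
    exact withDensity_mul μ hgm' (hr a)
  rw [hw]
  ext s hsm
  rw [Measure.restrict_apply hsm, ← Kernel.withDensity_rnDeriv_of_subset_compl_mutuallySingularSetSlice
    (hsm.inter hms.compl) Set.inter_subset_right]
  refine measure_congr ?_
  have h0 := Kernel.withDensity_rnDeriv_mutuallySingularSetSlice K η a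
  filter_upwards [compl_mem_ae_iff.mpr h0] with y hy
  exact propext (and_iff_left hy)

/-- The density of the absolutely continuous part of a Markov kernel is enlarged to a jointly
measurable family of probability densities, infinite on the null set carrying the singular part. -/
theorem exists_measurable_probability_density {α 𝓨 : Type*} [MeasurableSpace α]
    [MeasurableSpace 𝓨] (μ : Measure 𝓨) [SFinite μ] (ρ : Density μ) {k : α → 𝓨 → ℝ≥0∞}
    (hk : Measurable (Function.uncurry k)) (hk1 : ∀ a, ∫⁻ y, k a y ∂μ ≤ 1)
    {N : Set (α × 𝓨)} (hN : MeasurableSet N) (hN0 : ∀ a, μ (Prod.mk a ⁻¹' N) = 0) :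
    ∃ p : α → 𝓨 → ℝ≥0∞, Measurable (Function.uncurry p) ∧ (∀ a, ∫⁻ y, p a y ∂μ = 1) ∧
      (∀ a y, k a y ≤ p a y) ∧ ∀ a y, (a, y) ∈ N → p a y = ∞ := by
  have hρ := ρ.2.1
  have hc : Measurable fun a => 1 - ∫⁻ y, k a y ∂μ :=
    measurable_const.sub hk.lintegral_prod_right'
  -- The mass missing from `k` is supplied by a multiple of `ρ`; the infinite term sits on a null
  -- set and leaves the integral unchanged.
  refine ⟨fun a y => k a y + (1 - ∫⁻ y, k a y ∂μ) * ρ.1 y + N.indicator (fun _ => ∞) (a, y),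
    ?_, fun a => ?_, fun a y => ?_, fun a y h => by simp [h]⟩
  · exact (hk.add ((hc.comp measurable_fst).mul (hρ.comp measurable_snd))).add
      (measurable_const.indicator hN)
  · have hk' : Measurable (k a) := hk.of_uncurry_left
    have hz : ∫⁻ y, N.indicator (fun _ => ∞) (a, y) ∂μ = 0 := by
      refine (lintegral_congr_ae (g := fun _ => (0 : ℝ≥0∞)) ?_).trans lintegral_zero
      filter_upwards [compl_mem_ae_iff.mpr (hN0 a)] with y hy
      exact Set.indicator_of_notMem (show (a, y) ∉ N from hy) (fun _ => (∞ : ℝ≥0∞))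
    change ∫⁻ y, ((k a y + (1 - ∫⁻ y, k a y ∂μ) * ρ.1 y) + N.indicator (fun _ => ∞) (a, y)) ∂μ = 1
    rw [lintegral_add_left (by fun_prop), lintegral_add_left hk', lintegral_const_mul _ hρ, ρ.2.2, hz, mul_one, add_zero]
    exact add_tsub_cancel_of_le (hk1 a)
  · exact le_self_add.trans le_self_add

/-- If `P ≪ P'`, then the singular part of `P` is carried by the singular set of `P'`, and off the
singular set the densities with respect to `μ` are related by `dP/dP'`. -/
theorem ae_rnDeriv_mul_density_eq {𝓨 : Type*} [MeasurableSpace 𝓨] {μ P P' : Measure 𝓨}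
    [SigmaFinite μ] [IsFiniteMeasure P] [IsFiniteMeasure P'] (hP : P ≪ P') {N N' : Set 𝓨}
    {k k' : 𝓨 → ℝ≥0∞} (hN : MeasurableSet N) (hN' : MeasurableSet N') (hk : Measurable k)
    (hk' : Measurable k') (hN0 : μ N = 0) (hN0' : μ N' = 0)
    (hd : P.restrict Nᶜ = μ.withDensity k) (hd' : P'.restrict N'ᶜ = μ.withDensity k') :
    ∀ᵐ y ∂P, (y ∈ N → y ∈ N') ∧
      (y ∉ N → k y ≠ 0 ∧ k y ≠ ∞ ∧ k' y ≠ 0 ∧ k' y ≠ ∞ ∧ P.rnDeriv P' y * k' y = k y) := by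
  have hfin {P : Measure 𝓨} [IsFiniteMeasure P] {N : Set 𝓨} {k : 𝓨 → ℝ≥0∞} (hk : Measurable k)
      (hd : P.restrict N = μ.withDensity k) : ∫⁻ y, k y ∂μ ≠ ∞ := by
    have := congrArg (fun m => m Set.univ) hd
    simp only [withDensity_apply _ MeasurableSet.univ, Measure.restrict_univ] at this
    rw [← this]
    exact measure_ne_top _ _
  -- Off `N'` the measure `P'` has a density, so it does not charge the `μ`-null set `N`; neither
  -- does `P ≪ P'`.
  have h1 : P (N \ N') = 0 := by
    refine hP ?_
    have : P'.restrict N'ᶜ N = 0 := by rw [hd']; exact withDensity_absolutelyContinuous _ _ hN0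
    rwa [Measure.restrict_apply hN] at this
  have ht : Measurable (P.rnDeriv P') := Measure.measurable_rnDeriv _ _
  have hz {m : Measure 𝓨} (hm : m ≪ μ) : m.restrict (N ∪ N')ᶜ = m := by
    refine Measure.restrict_eq_self_of_ae_mem ?_
    exact hm.ae_le (compl_mem_ae_iff.mpr (measure_union_null hN0 hN0'))
  -- Both `N` and `N'` are `μ`-null, so removing their union leaves both densities unchanged. There
  -- the chain rule holds between measures, and uniqueness of densities makes it pointwise.
  have h2 : μ.withDensity k = μ.withDensity (k' * P.rnDeriv P') := by
    have e1 : P.restrict (N ∪ N')ᶜ = μ.withDensity k := by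
      rw [← hz (withDensity_absolutelyContinuous μ k), ← hd,
        Measure.restrict_restrict (hN.union hN').compl]
      congr 1
      ext y; simp; tauto
    have e2 : P'.restrict (N ∪ N')ᶜ = μ.withDensity k' := by
      rw [← hz (withDensity_absolutelyContinuous μ k'), ← hd',
        Measure.restrict_restrict (hN.union hN').compl]
      congr 1
      ext y; simp
    rw [withDensity_mul μ hk' ht, ← e1, ← e2, ← restrict_withDensity (hN.union hN').compl,
      Measure.withDensity_rnDeriv_eq _ _ hP]
  have h3 : k =ᵐ[μ] k' * P.rnDeriv P' :=
    (withDensity_eq_iff hk.aemeasurable (hk'.mul ht).aemeasurable (hfin hk hd)).mp h2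
  have h4 : ∀ᵐ y ∂μ.withDensity k, k y ≠ 0 :=
    (ae_withDensity_iff hk).mpr (.of_forall fun y hy => hy)
  have h5 : ∀ᵐ y ∂μ.withDensity k, k y ≠ 0 ∧ k y ≠ ∞ ∧ k' y ≠ 0 ∧ k' y ≠ ∞ ∧
      P.rnDeriv P' y * k' y = k y := by
    have hac := withDensity_absolutelyContinuous μ k
    filter_upwards [h4, hac.ae_le h3, hac.ae_le (ae_lt_top hk (hfin hk hd)),
      hac.ae_le (ae_lt_top hk' (hfin hk' hd'))] with y a b c d
    have b' : k y = k' y * P.rnDeriv P' y := b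
    exact ⟨a, c.ne, fun h => a (by rw [b', h, zero_mul]), d.ne, by rw [b', mul_comm]⟩
  rw [← hd, ae_restrict_iff' hN.compl] at h5
  filter_upwards [compl_mem_ae_iff.mpr h1, h5] with y hy h
  exact ⟨fun hn => by_contra fun hn' => hy ⟨hn, hn'⟩, h⟩

/-! ### Relative entropy of kernels -/

theorem measurable_klDiv_kernel {β 𝓨 : Type*} [MeasurableSpace β] [MeasurableSpace 𝓨]
    [MeasurableSpace.CountableOrCountablyGenerated β 𝓨] (κ κ' : Kernel β 𝓨) [IsFiniteKernel κ]
    [IsFiniteKernel κ'] : Measurable fun b => klDiv (κ b) (κ' b) := by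
  classical
  have h : (fun b => klDiv (κ b) (κ' b)) = fun b => if κ b ≪ κ' b then
      ∫⁻ y, ENNReal.ofReal (klFun (Kernel.rnDeriv κ κ' b y).toReal) ∂κ' b else ∞ := by
    ext b
    rw [klDiv_eq_lintegral_klFun]
    refine if_congr Iff.rfl (lintegral_congr_ae ?_) rfl
    filter_upwards [Kernel.rnDeriv_eq_rnDeriv_measure (κ := κ) (η := κ') (a := b)] with y hy
    rw [hy]
  rw [h]
  refine Measurable.ite (Kernel.measurableSet_absolutelyContinuous κ κ') ?_ measurable_const
  exact Measurable.lintegral_kernel_prod_right'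
    (f := fun p : β × 𝓨 => ENNReal.ofReal (klFun (Kernel.rnDeriv κ κ' p.1 p.2).toReal))
    ((measurable_klFun.comp (Kernel.measurable_rnDeriv κ κ').ennreal_toReal).ennreal_ofReal)

/-- Nonnegativity of `klFun` gives `r log r ≥ r - 1 ≥ -1`, hence `|r log r| ≤ r log r + 2`. -/
theorem integral_abs_llr_le {𝓨 : Type*} [MeasurableSpace 𝓨] {P P' : Measure 𝓨}
    [IsProbabilityMeasure P] [IsProbabilityMeasure P'] (h : P ≪ P')
    (hi : Integrable (llr P P') P) :
    ∫ y, |llr P P' y| ∂P ≤ (klDiv P P').toReal + 2 := by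
  rw [toReal_klDiv_of_measure_eq h (by simp), ← integral_rnDeriv_smul h, ← integral_rnDeriv_smul h]
  have hi' : Integrable (fun y => (P.rnDeriv P' y).toReal • llr P P' y) P' :=
    (integrable_rnDeriv_smul_iff h).mpr hi
  have h2 : ∫ y, (P.rnDeriv P' y).toReal • llr P P' y ∂P' + 2
      = ∫ y, ((P.rnDeriv P' y).toReal • llr P P' y + 2) ∂P' := by
    rw [integral_add hi' (integrable_const _)]; simp
  rw [h2]
  refine integral_mono ((integrable_rnDeriv_smul_iff h).mpr hi.abs)
    (hi'.add (integrable_const _)) fun y => ?_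
  simp only [smul_eq_mul, llr]
  have h0 : 0 ≤ (P.rnDeriv P' y).toReal := ENNReal.toReal_nonneg
  have hk := klFun_nonneg h0
  rw [klFun] at hk
  rcases le_total 0 (Real.log (P.rnDeriv P' y).toReal) with hl | hl
  · rw [abs_of_nonneg hl]; linarith
  · rw [abs_of_nonpos hl]; linarith

/-- If the expected relative entropy of two kernels is finite, then the log-likelihood ratio is
integrable and its integral is the expected relative entropy. -/
theorem integral_log_rnDeriv_compProd {β 𝓨 : Type*} [MeasurableSpace β] [MeasurableSpace 𝓨]
    [MeasurableSpace.CountableOrCountablyGenerated β 𝓨] {ξ : Measure β} [IsFiniteMeasure ξ]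
    (κ κ' : Kernel β 𝓨) [IsMarkovKernel κ] [IsMarkovKernel κ']
    (hξ : ∫⁻ b, klDiv (κ b) (κ' b) ∂ξ ≠ ∞) :
    (∀ᵐ b ∂ξ, κ b ≪ κ' b) ∧
    Integrable (fun p : β × 𝓨 => Real.log (Kernel.rnDeriv κ κ' p.1 p.2).toReal) (ξ ⊗ₘ κ) ∧
    ∫ p, Real.log (Kernel.rnDeriv κ κ' p.1 p.2).toReal ∂(ξ ⊗ₘ κ)
      = (∫⁻ b, klDiv (κ b) (κ' b) ∂ξ).toReal := by
  have hm := measurable_klDiv_kernel κ κ'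
  have hfin := ae_lt_top hm hξ
  have hac : ∀ᵐ b ∂ξ, κ b ≪ κ' b ∧ Integrable (llr (κ b) (κ' b)) (κ b) := by
    filter_upwards [hfin] with b hb using klDiv_ne_top_iff.mp hb.ne
  have heq (b : β) (hb : κ b ≪ κ' b) :
      (fun y => Real.log (Kernel.rnDeriv κ κ' b y).toReal) =ᵐ[κ b] llr (κ b) (κ' b) := by
    filter_upwards [hb.ae_le (Kernel.rnDeriv_eq_rnDeriv_measure (κ := κ) (η := κ') (a := b))]
      with y hy
    rw [hy, llr]
  have hL : Measurable fun p : β × 𝓨 => Real.log (Kernel.rnDeriv κ κ' p.1 p.2).toReal :=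
    (Kernel.measurable_rnDeriv κ κ').ennreal_toReal.log
  have hint : Integrable (fun p : β × 𝓨 => Real.log (Kernel.rnDeriv κ κ' p.1 p.2).toReal)
      (ξ ⊗ₘ κ) := by
    rw [Measure.integrable_compProd_iff hL.aestronglyMeasurable]
    refine ⟨?_, ?_⟩
    · filter_upwards [hac] with b hb
      exact hb.2.congr (heq b hb.1).symm
    -- Integrability on each fibre is not enough; the fibrewise `L¹` norms are dominated by the
    -- relative entropy plus 2, which is integrable over `ξ`.
    · refine Integrable.mono' ((integrable_toReal_of_lintegral_ne_top hm.aemeasurable hξ).add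
        (integrable_const 2)) ?_ ?_
      · exact (hL.norm.stronglyMeasurable.integral_kernel_prod_right').aestronglyMeasurable
      · filter_upwards [hac] with b hb
        rw [Real.norm_of_nonneg (integral_nonneg fun y => norm_nonneg _)]
        refine le_trans (le_of_eq (integral_congr_ae ?_)) (integral_abs_llr_le hb.1 hb.2)
        filter_upwards [heq b hb.1] with y hy
        rw [hy, Real.norm_eq_abs]
  refine ⟨hac.mono fun b hb => hb.1, hint, ?_⟩
  rw [Measure.integral_compProd hint, ← integral_toReal hm.aemeasurable hfin]
  refine integral_congr_ae ?_
  filter_upwards [hac] with b hb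
  rw [toReal_klDiv_of_measure_eq hb.1 (by simp)]
  exact integral_congr_ae (heq b hb.1)

/-! ### Comparison of expectations and of log losses -/

/-- With every negative part moved across, no subtraction remains, so the inequality can be
integrated even where values are infinite. -/
theorem toENNReal_add_le {a b : EReal} {f : ℝ} (h : a ≤ b + f) :
    a.toENNReal + (-b).toENNReal + ENNReal.ofReal (-f)
      ≤ (-a).toENNReal + b.toENNReal + ENNReal.ofReal f := by
  induction b with
  | bot =>
    have : a = ⊥ := by simpa using h
    simp [this]
  | top => simp
  | coe b =>
    induction a with
    | bot => simp
    | top => exact absurd h (by rw [← EReal.coe_add]; exact not_le.mpr (EReal.coe_lt_top _))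
    | coe a =>
      have h' : a ≤ b + f := by exact_mod_cast h
      simp only [← EReal.coe_neg, EReal.toENNReal_of_ne_top (EReal.coe_ne_top _), EReal.toReal_coe]
      rw [← ENNReal.toReal_le_toReal (by finiteness) (by finiteness)]
      rw [ENNReal.toReal_add (by finiteness) (by finiteness),
        ENNReal.toReal_add (by finiteness) (by finiteness),
        ENNReal.toReal_add (by finiteness) (by finiteness),
        ENNReal.toReal_add (by finiteness) (by finiteness)]
      simp only [ENNReal.toReal_ofReal']
      have e (x : ℝ) : max x 0 - max (-x) 0 = x := by
        rcases le_total 0 x with hx | hx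
        · rw [max_eq_left hx, max_eq_right (by linarith)]; ring
        · rw [max_eq_right hx, max_eq_left (by linarith)]; ring
      linarith [e a, e b, e f]

theorem expectation_le_add {Ω : Type*} [MeasurableSpace Ω] {Q : Measure Ω} {A B : Ω → EReal}
    {f : Ω → ℝ} (hA : Measurable A) (hB : Measurable B) (hf : Integrable f Q)
    (h : ∀ᵐ ω ∂Q, A ω ≤ B ω + f ω) (hBfin : ∫⁻ ω, (B ω).toENNReal ∂Q ≠ ∞) :
    ∫⁻ ω, (A ω).toENNReal ∂Q ≠ ∞ ∧
      expectation Q A ≤ expectation Q B + ((∫ ω, f ω ∂Q : ℝ) : EReal) := by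
  have hf1 : ∫⁻ ω, ENNReal.ofReal (f ω) ∂Q ≠ ∞ :=
    ((lintegral_mono fun ω => Real.ofReal_le_enorm _).trans_lt hf.2).ne
  have hf2 : ∫⁻ ω, ENNReal.ofReal (-f ω) ∂Q ≠ ∞ :=
    ((lintegral_mono fun ω => Real.ofReal_le_enorm _).trans_lt hf.neg.2).ne
  have hA' := hA.ereal_toENNReal
  have hAn : Measurable fun ω => (-A ω).toENNReal := (continuous_neg.measurable.comp hA).ereal_toENNReal
  have hB' := hB.ereal_toENNReal
  have hBn : Measurable fun ω => (-B ω).toENNReal := (continuous_neg.measurable.comp hB).ereal_toENNReal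
  have hfin : ∫⁻ ω, (A ω).toENNReal ∂Q ≠ ∞ := by
    refine ((lintegral_mono_ae (g := fun ω => (B ω).toENNReal + ENNReal.ofReal (f ω))
      ?_).trans_lt ?_).ne
    · filter_upwards [h] with ω hω
      refine (EReal.toENNReal_le_toENNReal hω).trans (EReal.toENNReal_add_le.trans ?_)
      simp
    · rw [lintegral_add_left hB']
      exact ENNReal.add_lt_top.mpr ⟨hBfin.lt_top, hf1.lt_top⟩
  refine ⟨hfin, ?_⟩
  have key : ∫⁻ ω, (A ω).toENNReal ∂Q + ∫⁻ ω, (-B ω).toENNReal ∂Q + ∫⁻ ω, ENNReal.ofReal (-f ω) ∂Q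
      ≤ ∫⁻ ω, (-A ω).toENNReal ∂Q + ∫⁻ ω, (B ω).toENNReal ∂Q + ∫⁻ ω, ENNReal.ofReal (f ω) ∂Q := by
    rw [← lintegral_add_left hA', ← lintegral_add_left (by fun_prop), ← lintegral_add_left hAn,
      ← lintegral_add_left (by fun_prop)]
    refine lintegral_mono_ae ?_
    filter_upwards [h] with ω hω using toENNReal_add_le hω
  rw [integral_eq_lintegral_pos_part_sub_lintegral_neg_part hf]
  unfold expectation
  generalize ∫⁻ ω, (A ω).toENNReal ∂Q = a at *
  generalize ∫⁻ ω, (-A ω).toENNReal ∂Q = a' at *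
  generalize ∫⁻ ω, (B ω).toENNReal ∂Q = b at *
  generalize ∫⁻ ω, (-B ω).toENNReal ∂Q = b' at *
  generalize ∫⁻ ω, ENNReal.ofReal (f ω) ∂Q = c at *
  generalize ∫⁻ ω, ENNReal.ofReal (-f ω) ∂Q = c' at *
  -- An infinite negative part of `A` makes its expectation `-∞`, as `a` is finite. Otherwise `key`
  -- forces `b'` to be finite and the claim is real arithmetic.
  by_cases ha' : a' = ∞
  · rw [ha']; simp
  have hb' : b' ≠ ∞ := by
    have : b' ≤ a' + b + c := (le_add_self.trans le_self_add).trans key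
    exact ne_top_of_le_ne_top (by finiteness) this
  lift a to NNReal using hfin
  lift a' to NNReal using ha'
  lift b to NNReal using hBfin
  lift b' to NNReal using hb'
  lift c to NNReal using hf1
  lift c' to NNReal using hf2
  have key' : (a : ℝ) + b' + c' ≤ a' + b + c := by exact_mod_cast key
  have e (x : NNReal) : (((x : ℝ≥0∞)) : EReal) = ((x : ℝ) : EReal) := rfl
  simp only [e, ENNReal.coe_toReal, ← EReal.coe_sub, ← EReal.coe_add, EReal.coe_le_coe_iff]
  linarith

/-- Write `log (s/q)` as `log (s/k) + log t + log (k'/q)` and bound `k'` by `p`. Finiteness of `p/q`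
rules out `q = 0`, and `p = ∞` unless `q = ∞`. -/
theorem neg_log_le_add {s k t k' p q : ℝ≥0∞} (hk0 : k ≠ 0) (hk : k ≠ ∞) (hk0' : k' ≠ 0)
    (hk' : k' ≠ ∞) (ht : t * k' = k) (hp : k' ≤ p) (hs : s / k ≠ ∞) (hq : p / q ≠ ∞) :
    -ENNReal.log q ≤ -ENNReal.log s +
      ((Real.log t.toReal + ((s / k).toReal - 1) + ((p / q).toReal - 1) : ℝ) : EReal) := by
  have hp0 : p ≠ 0 := fun h => hk0' (by simpa [h] using hp)
  have hq0 : q ≠ 0 := fun h => hq (by rw [h, ENNReal.div_zero hp0])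
  rcases eq_or_ne q ∞ with rfl | hqt
  · simp
  have hpt : p ≠ ∞ := fun h => hq (by rw [h, ENNReal.top_div_of_ne_top hqt])
  have hst : s ≠ ∞ := fun h => hs (by rw [h, ENNReal.top_div_of_ne_top hk])
  rcases eq_or_ne s 0 with rfl | hs0
  · rw [ENNReal.log_zero, EReal.neg_bot, EReal.top_add_coe]
    exact le_top
  have ht0 : t ≠ 0 := fun h => hk0 (by rw [← ht, h, zero_mul])
  have htt : t ≠ ∞ := fun h => hk (by rw [← ht, h, ENNReal.top_mul hk0'])
  rw [ENNReal.log_pos_real hq0 hqt, ENNReal.log_pos_real hs0 hst]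
  have h1 : Real.log (s.toReal / k.toReal) ≤ s.toReal / k.toReal - 1 :=
    Real.log_le_sub_one_of_pos (div_pos (ENNReal.toReal_pos hs0 hst) (ENNReal.toReal_pos hk0 hk))
  have h2 : Real.log (p.toReal / q.toReal) ≤ p.toReal / q.toReal - 1 :=
    Real.log_le_sub_one_of_pos (div_pos (ENNReal.toReal_pos hp0 hpt) (ENNReal.toReal_pos hq0 hqt))
  have h3 : Real.log k'.toReal ≤ Real.log p.toReal :=
    Real.log_le_log (ENNReal.toReal_pos hk0' hk') (ENNReal.toReal_mono hpt hp)
  have h4 : Real.log k.toReal = Real.log t.toReal + Real.log k'.toReal := by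
    rw [← ht, ENNReal.toReal_mul, Real.log_mul (ENNReal.toReal_pos ht0 htt).ne'
      (ENNReal.toReal_pos hk0' hk').ne']
  rw [Real.log_div (ENNReal.toReal_pos hs0 hst).ne' (ENNReal.toReal_pos hk0 hk).ne'] at h1
  rw [Real.log_div (ENNReal.toReal_pos hp0 hpt).ne' (ENNReal.toReal_pos hq0 hqt).ne'] at h2
  rw [← EReal.coe_neg, ← EReal.coe_neg, ← EReal.coe_add, EReal.coe_le_coe_iff,
    ENNReal.toReal_div, ENNReal.toReal_div]
  linarith

/-! ### The joint law of outcome and sample -/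

theorem expectation_map {Ω Ω' : Type*} [MeasurableSpace Ω] [MeasurableSpace Ω'] {Q : Measure Ω}
    {h : Ω → Ω'} (hh : Measurable h) {g : Ω' → EReal} (hg : Measurable g) :
    expectation (Q.map h) g = expectation Q (g ∘ h) := by
  have hg' : Measurable fun ω => (-g ω).toENNReal :=
    (continuous_neg.measurable.comp hg).ereal_toENNReal
  unfold expectation
  rw [lintegral_map hg.ereal_toENNReal hh, lintegral_map hg' hh]
  rfl

section Law

variable {𝓦 𝓧 𝓨 : Type*} [MeasurableSpace 𝓦] [MeasurableSpace 𝓧] [MeasurableSpace 𝓨] {n : ℕ}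
  {PW : Measure 𝓦} [IsProbabilityMeasure PW] {PX : Kernel 𝓦 𝓧} [IsMarkovKernel PX]
  {K : Kernel (𝓦 × 𝓧) 𝓨} [IsMarkovKernel K] (π : Kernel (𝓧 × (Fin n → 𝓧 × 𝓨)) 𝓦)
  [IsMarkovKernel π]

theorem lintegral_jointLaw_compProd {F : Outcome 𝓦 𝓧 𝓨 n × 𝓦 → ℝ≥0∞} (hF : Measurable F) :
    ∫⁻ p, F p ∂(jointLaw n PW (PX ⊗ₖ K) ⊗ₘ π.comap Outcome.observed Outcome.measurable_observed)
      = ∫⁻ w, ∫⁻ z, ∫⁻ x, ∫⁻ y, ∫⁻ w', F ((w, z, x, y), w') ∂π (x, z) ∂K (w, x) ∂PX w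
          ∂iidKernel n (PX ⊗ₖ K) w ∂PW := by
  have hF1 : Measurable fun ω : Outcome 𝓦 𝓧 𝓨 n => ∫⁻ w', F (ω, w') ∂π ω.observed :=
    Measurable.lintegral_kernel_prod_right' (κ := π.comap _ Outcome.measurable_observed) hF
  rw [Measure.lintegral_compProd hF]
  simp only [Kernel.comap_apply]
  rw [jointLaw, Measure.lintegral_compProd hF1]
  refine lintegral_congr fun w => ?_
  have hF2 := hF1.comp (measurable_prodMk_left (x := w))
  rw [Kernel.prod_apply]
  refine (lintegral_prod _ hF2.aemeasurable).trans (lintegral_congr fun z => ?_)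
  exact Kernel.lintegral_compProd _ _ _ (hF2.comp (measurable_prodMk_left (x := z)))

/-- Replace the quantity to be predicted. -/
def resample (e : (Outcome 𝓦 𝓧 𝓨 n × 𝓦) × 𝓨) : Outcome 𝓦 𝓧 𝓨 n × 𝓦 :=
  ((e.1.1.1, e.1.1.2.1, e.1.1.2.2.1, e.2), e.1.2)

theorem measurable_resample :
    Measurable (resample : (Outcome 𝓦 𝓧 𝓨 n × 𝓦) × 𝓨 → Outcome 𝓦 𝓧 𝓨 n × 𝓦) := by
  unfold resample; fun_prop

theorem measurable_omniscient : Measurable (Outcome.omniscient : Outcome 𝓦 𝓧 𝓨 n → _) := by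
  unfold Outcome.omniscient Outcome.X Outcome.W; fun_prop

/-- The kernel generating the quantity to be predicted from the true parameters. -/
noncomputable def trueKernel (n : ℕ) (K : Kernel (𝓦 × 𝓧) 𝓨) : Kernel (Outcome 𝓦 𝓧 𝓨 n × 𝓦) 𝓨 :=
  K.comap (fun p => (p.1.W, p.1.X)) (by unfold Outcome.X Outcome.W; fun_prop)

/-- The kernel generating the quantity to be predicted from the sampled parameters. -/
noncomputable def sampleKernel (n : ℕ) (K : Kernel (𝓦 × 𝓧) 𝓨) :
    Kernel (Outcome 𝓦 𝓧 𝓨 n × 𝓦) 𝓨 :=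
  K.comap (fun p => (p.2, p.1.X)) (by unfold Outcome.X; fun_prop)

instance : IsMarkovKernel (trueKernel n K) := by unfold trueKernel; infer_instance

instance : IsMarkovKernel (sampleKernel n K) := by unfold sampleKernel; infer_instance

/-- Given the parameters, the fresh observation and the sample, the quantity to be predicted has
conditional distribution `K`. -/
theorem map_resample :
    ((jointLaw n PW (PX ⊗ₖ K) ⊗ₘ π.comap Outcome.observed Outcome.measurable_observed)
      ⊗ₘ trueKernel n K).map resample
      = jointLaw n PW (PX ⊗ₖ K) ⊗ₘ π.comap Outcome.observed Outcome.measurable_observed := by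
  refine Measure.ext_of_lintegral _ fun F hF => ?_
  have hFr : Measurable fun e : (Outcome 𝓦 𝓧 𝓨 n × 𝓦) × 𝓨 => F (resample e) :=
    hF.comp measurable_resample
  rw [lintegral_map hF measurable_resample, Measure.lintegral_compProd hFr,
    lintegral_jointLaw_compProd π hF,
    lintegral_jointLaw_compProd π (Measurable.lintegral_kernel_prod_right' hFr)]
  refine lintegral_congr fun w => lintegral_congr fun z => lintegral_congr fun x => ?_
  -- The discarded `y` integrates to one because `π` sees only `(x, z)`; for the same reason Fubini
  -- exchanges `w'` and the new `y`.
  change ∫⁻ _, ∫⁻ w', ∫⁻ y, F ((w, z, x, y), w') ∂K (w, x) ∂π (x, z) ∂K (w, x) = _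
  rw [lintegral_const, measure_univ, mul_one]
  exact lintegral_lintegral_swap (f := fun w' y => F ((w, z, x, y), w'))
    (hF.comp (by fun_prop : Measurable fun p : 𝓦 × 𝓨 =>
      (((w, z, x, p.2), p.1) : Outcome 𝓦 𝓧 𝓨 n × 𝓦))).aemeasurable

end Law

/-! ### The mixture predictor -/

section Mixture

variable {𝓦 𝓧 𝓨 : Type*} [MeasurableSpace 𝓦] [MeasurableSpace 𝓧] [MeasurableSpace 𝓨]

/-- The mixture of a measurable family of densities with respect to a Markov kernel. -/
theorem exists_mixture {𝓥 : Type*} [MeasurableSpace 𝓥] (μ : Measure 𝓨) [SFinite μ]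
    (π : Kernel 𝓥 𝓦) [IsMarkovKernel π] {p : 𝓥 × 𝓦 → 𝓨 → ℝ≥0∞}
    (hp : Measurable (Function.uncurry p)) (hp1 : ∀ a, ∫⁻ y, p a y ∂μ = 1) :
    ∃ q : 𝓥 → Density μ, Measurable (fun a : 𝓥 × 𝓨 => (q a.1).1 a.2) ∧
      ∀ v y, (q v).1 y = ∫⁻ w, p (v, w) y ∂π v := by
  have hm : Measurable fun a : 𝓥 × 𝓨 => ∫⁻ w, p (a.1, w) a.2 ∂π a.1 :=
    Measurable.lintegral_kernel_prod_right' (κ := π.comap Prod.fst measurable_fst)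
      (f := fun b : (𝓥 × 𝓨) × 𝓦 => p (b.1.1, b.2) b.1.2)
      (hp.comp (by fun_prop : Measurable fun b : (𝓥 × 𝓨) × 𝓦 => ((b.1.1, b.2), b.1.2)))
  refine ⟨fun v => ⟨fun y => ∫⁻ w, p (v, w) y ∂π v, hm.comp measurable_prodMk_left, ?_⟩, hm,
    fun v y => rfl⟩
  rw [lintegral_lintegral_swap (f := fun y w => p (v, w) y)
    (hp.comp (by fun_prop : Measurable fun b : 𝓨 × 𝓦 => ((v, b.2), b.1))).aemeasurable]
  simp [hp1]

/-- Off `N` the factor `k` of `P` cancels the denominator, leaving at most `∫ s dμ`; mass of `s`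
where `k` vanishes is lost. -/
theorem lintegral_div_density_le_one {P μ : Measure 𝓨} {s k : 𝓨 → ℝ≥0∞} {N : Set 𝓨}
    (hN : MeasurableSet N) (hs : Measurable s) (hk : Measurable k)
    (hd : P.restrict Nᶜ = μ.withDensity k) (hs1 : ∫⁻ y, s y ∂μ ≤ 1) :
    ∫⁻ y, Nᶜ.indicator (fun y => s y / k y) y ∂P ≤ 1 := by
  rw [lintegral_indicator hN.compl, hd,
    lintegral_withDensity_eq_lintegral_mul (h_mf := hk) (g := fun y => s y / k y) _ (hs.div hk)]
  exact (lintegral_mono fun y => ENNReal.mul_div_le).trans hs1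

end Mixture

/-- A decision rule of the omniscient predictor is matched, up to the expected relative entropy, by
the mixture of the conditional densities over the sampled parameters. -/
theorem learningRisk_logLoss_le_add {𝓦 𝓧 𝓨 : Type*} [MeasurableSpace 𝓦] [MeasurableSpace 𝓧]
    [MeasurableSpace 𝓨] [MeasurableSpace.CountablyGenerated 𝓨] {n : ℕ}
    {PW : Measure 𝓦} [IsProbabilityMeasure PW] {PX : Kernel 𝓦 𝓧} [IsMarkovKernel PX]
    {K : Kernel (𝓦 × 𝓧) 𝓨} [IsMarkovKernel K] (π : Kernel (𝓧 × (Fin n → 𝓧 × 𝓨)) 𝓦)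
    [IsMarkovKernel π] (μ : Measure 𝓨) [SigmaFinite μ] (ψ : 𝓧 × 𝓦 → Density μ)
    (hψ : Measurable fun p : (𝓧 × 𝓦) × 𝓨 => logLoss μ p.2 (ψ p.1))
    (hpos : ∫⁻ ω : Outcome 𝓦 𝓧 𝓨 n, (logLoss μ ω.Y (ψ ω.omniscient)).toENNReal
      ∂jointLaw n PW (PX ⊗ₖ K) ≠ ∞)
    (hD : ∫⁻ p, klDiv (K (p.1.W, p.1.X)) (K (p.2, p.1.X)) ∂(jointLaw n PW (PX ⊗ₖ K) ⊗ₘ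
      π.comap Outcome.observed Outcome.measurable_observed) ≠ ∞) :
    learningRisk (logLoss μ) n PW (PX ⊗ₖ K) ≤
      expectation (jointLaw n PW (PX ⊗ₖ K)) (fun ω => logLoss μ ω.Y (ψ ω.omniscient)) +
      ((∫⁻ p, klDiv (K (p.1.W, p.1.X)) (K (p.2, p.1.X)) ∂(jointLaw n PW (PX ⊗ₖ K) ⊗ₘ
        π.comap Outcome.observed Outcome.measurable_observed) : ℝ≥0∞) : EReal) := by
  obtain ⟨k, N, hk, hN, hkN⟩ := exists_measurable_density K μ
  have hka (a) : Measurable (k a) := hk.of_uncurry_left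
  have hNa (a) : MeasurableSet (Prod.mk a ⁻¹' N) := measurable_prodMk_left hN
  have hk1 (a) : ∫⁻ y, k a y ∂μ ≤ 1 := by
    have := congrArg (fun m => m Set.univ) (hkN a).2
    simp only [withDensity_apply _ MeasurableSet.univ, Measure.restrict_univ] at this
    rw [← this]
    exact (Measure.restrict_apply_le _ _).trans prob_le_one
  set P := jointLaw n PW (PX ⊗ₖ K)
  set Q := P ⊗ₘ π.comap Outcome.observed Outcome.measurable_observed with hQ
  -- A value of `ψ` serves as the reference density `ρ`; for `μ = 0` no density would exist.
  obtain ⟨ω₀⟩ : Nonempty (Outcome 𝓦 𝓧 𝓨 n) := P.nonempty_of_neZero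
  obtain ⟨p, hp, hp1, hkp, hNp⟩ :=
    exists_measurable_probability_density μ (ψ ω₀.omniscient) hk hk1 hN fun a => (hkN a).1
  obtain ⟨q, hq, hqp⟩ := exists_mixture μ π
    (p := fun b : (𝓧 × (Fin n → 𝓧 × 𝓨)) × 𝓦 => p (b.2, b.1.1))
    (hp.comp (by fun_prop : Measurable fun b : ((𝓧 × (Fin n → 𝓧 × 𝓨)) × 𝓦) × 𝓨 =>
      ((b.1.2, b.1.1.1), b.2))) fun a => hp1 _
  -- Exponentiating minus the loss recovers the density.
  have hs : Measurable fun b : (𝓧 × 𝓦) × 𝓨 => (ψ b.1).1 b.2 := by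
    have := (continuous_neg.measurable.comp hψ).ereal_exp
    simpa [Function.comp_def, logLoss] using this
  -- Redrawing `Y` after `W'` exhibits its conditional law as a kernel; `resample` returns to `Q`.
  let Θ := Q ⊗ₘ trueKernel n K
  have hΘQ : Θ.map resample = Q := map_resample π
  have hΘP : Θ.map (fun e => (resample e).1) = P := by
    rw [show (fun e : (Outcome 𝓦 𝓧 𝓨 n × 𝓦) × 𝓨 => (resample e).1) = Prod.fst ∘ resample from rfl,
      ← Measure.map_map measurable_fst measurable_resample, hΘQ]
    exact Measure.fst_compProd _ _
  -- the three terms of the comparison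
  let t (e : (Outcome 𝓦 𝓧 𝓨 n × 𝓦) × 𝓨) : ℝ≥0∞ :=
    Kernel.rnDeriv (trueKernel n K) (sampleKernel n K) e.1 e.2
  have ht : Measurable t := Kernel.measurable_rnDeriv _ _
  obtain ⟨hac, htint, htD⟩ :=
    integral_log_rnDeriv_compProd (ξ := Q) (trueKernel n K) (sampleKernel n K) hD
  let a (e : (Outcome 𝓦 𝓧 𝓨 n × 𝓦) × 𝓨) : (𝓦 × 𝓧) × 𝓨 := ((e.1.1.1, e.1.1.2.2.1), e.2)
  let a' (e : (Outcome 𝓦 𝓧 𝓨 n × 𝓦) × 𝓨) : (𝓦 × 𝓧) × 𝓨 := ((e.1.2, e.1.1.2.2.1), e.2)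
  have ha : Measurable a := by fun_prop
  have ha' : Measurable a' := by fun_prop
  let u (e : (Outcome 𝓦 𝓧 𝓨 n × 𝓦) × 𝓨) : ℝ≥0∞ := Nᶜ.indicator
    (fun b : (𝓦 × 𝓧) × 𝓨 => (ψ (b.1.2, b.1.1)).1 b.2 / k b.1 b.2) (a e)
  have hsa : Measurable fun b : (𝓦 × 𝓧) × 𝓨 => (ψ (b.1.2, b.1.1)).1 b.2 :=
    hs.comp (by fun_prop : Measurable fun b : (𝓦 × 𝓧) × 𝓨 => ((b.1.2, b.1.1), b.2))
  have hu : Measurable u := ((hsa.div hk).indicator hN.compl).comp ha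
  have hu1 : ∫⁻ e, u e ∂Θ ≤ 1 := by
    rw [Measure.lintegral_compProd hu]
    refine (lintegral_mono fun r => ?_).trans (lintegral_const (1 : ℝ≥0∞) |>.trans (by simp)).le
    exact lintegral_div_density_le_one (N := Prod.mk (r.1.1, r.1.2.2.1) ⁻¹' N) (hNa _)
      (k := k (r.1.1, r.1.2.2.1)) (ψ (r.1.2.2.1, r.1.1)).2.1 (hka _) (hkN (r.1.1, r.1.2.2.1)).2
      (ψ (r.1.2.2.1, r.1.1)).2.2.le
  let v₀ (r : Outcome 𝓦 𝓧 𝓨 n × 𝓦) : ℝ≥0∞ :=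
    p (r.2, r.1.2.2.1) r.1.2.2.2 / (q (r.1.2.2.1, r.1.2.1)).1 r.1.2.2.2
  have hv₀ : Measurable v₀ :=
    (hp.comp (by fun_prop : Measurable fun r : Outcome 𝓦 𝓧 𝓨 n × 𝓦 =>
      ((r.2, r.1.2.2.1), r.1.2.2.2))).div
    (hq.comp (by fun_prop : Measurable fun r : Outcome 𝓦 𝓧 𝓨 n × 𝓦 =>
      ((r.1.2.2.1, r.1.2.1), r.1.2.2.2)))
  let v (e : (Outcome 𝓦 𝓧 𝓨 n × 𝓦) × 𝓨) : ℝ≥0∞ := v₀ (resample e)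
  have hv : Measurable v := hv₀.comp measurable_resample
  have hv1 : ∫⁻ e, v e ∂Θ ≤ 1 := by
    -- Under `Q` the sample `w'` is integrated first with `y` fixed, turning the numerator into the
    -- mixture itself.
    rw [← lintegral_map hv₀ measurable_resample, hΘQ, hQ, Measure.lintegral_compProd hv₀]
    refine (lintegral_mono fun ω => ?_).trans (lintegral_const (1 : ℝ≥0∞) |>.trans (by simp)).le
    change ∫⁻ w', p (w', ω.2.2.1) ω.2.2.2 / (q (ω.2.2.1, ω.2.1)).1 ω.2.2.2
      ∂π (ω.2.2.1, ω.2.1) ≤ 1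
    simp only [div_eq_mul_inv]
    have hpω : Measurable fun w' => p (w', ω.2.2.1) ω.2.2.2 :=
      hp.comp (by fun_prop : Measurable fun w' : 𝓦 => ((w', ω.2.2.1), ω.2.2.2))
    rw [lintegral_mul_const _ hpω, ← div_eq_mul_inv, hqp]
    exact ENNReal.div_self_le_one
  have hrel : ∀ᵐ e ∂Θ, (a e ∈ N → a' e ∈ N) ∧ (a e ∉ N → k (a e).1 (a e).2 ≠ 0 ∧
      k (a e).1 (a e).2 ≠ ∞ ∧ k (a' e).1 (a' e).2 ≠ 0 ∧ k (a' e).1 (a' e).2 ≠ ∞ ∧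
      t e * k (a' e).1 (a' e).2 = k (a e).1 (a e).2) := by
    have m1 : Measurable fun e => k (a e).1 (a e).2 := hk.comp ha
    have m2 : Measurable fun e => k (a' e).1 (a' e).2 := hk.comp ha'
    have n1 : Measurable fun e => a e ∈ N := measurableSet_setOfPred.mp (ha hN)
    have n2 : Measurable fun e => a' e ∈ N := measurableSet_setOfPred.mp (ha' hN)
    have z {f g : (Outcome 𝓦 𝓧 𝓨 n × 𝓦) × 𝓨 → ℝ≥0∞} (hf : Measurable f) (hg : Measurable g) :
        Measurable fun e => f e = g e := measurableSet_setOfPred.mp (measurableSet_eq_fun hf hg)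
    refine Measure.ae_compProd_of_ae_ae (measurableSet_setOfPred.mpr ((n1.imp n2).and (n1.not.imp
      ((z m1 measurable_const).not.and ((z m1 measurable_const).not.and
      ((z m2 measurable_const).not.and ((z m2 measurable_const).not.and
      (z (ht.mul m2) m1)))))))) ?_
    filter_upwards [hac] with r hr
    have h := ae_rnDeriv_mul_density_eq hr (hNa (r.1.1, r.1.2.2.1)) (hNa (r.2, r.1.2.2.1))
      (hka _) (hka _) (hkN _).1 (hkN _).1 (hkN _).2 (hkN _).2
    filter_upwards [h, hr.ae_le (Kernel.rnDeriv_eq_rnDeriv_measure (κ := trueKernel n K)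
      (η := sampleKernel n K) (a := r))] with y hy hty
    change _ ∧ (_ → _ ∧ _ ∧ _ ∧ _ ∧
      Kernel.rnDeriv (trueKernel n K) (sampleKernel n K) r y * _ = _)
    rw [hty]
    exact hy
  have hu_top := ae_lt_top hu (hu1.trans_lt ENNReal.one_lt_top).ne
  have hv_top := ae_lt_top hv (hv1.trans_lt ENNReal.one_lt_top).ne
  let f (e : (Outcome 𝓦 𝓧 𝓨 n × 𝓦) × 𝓨) : ℝ :=
    Real.log (t e).toReal + ((u e).toReal - 1) + ((v e).toReal - 1)
  have hui : Integrable (fun e => (u e).toReal) Θ :=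
    integrable_toReal_of_lintegral_ne_top hu.aemeasurable (hu1.trans_lt ENNReal.one_lt_top).ne
  have hvi : Integrable (fun e => (v e).toReal) Θ :=
    integrable_toReal_of_lintegral_ne_top hv.aemeasurable (hv1.trans_lt ENNReal.one_lt_top).ne
  have h1i : Integrable (fun _ => (1 : ℝ)) Θ := integrable_const _
  have hf : Integrable f Θ := (htint.add (hui.sub h1i)).add (hvi.sub h1i)
  have hfD : ∫ e, f e ∂Θ ≤
      (∫⁻ p, klDiv (K (p.1.W, p.1.X)) (K (p.2, p.1.X)) ∂Q).toReal := by
    have e1 : ∫ e, f e ∂Θ = ∫ e, Real.log (t e).toReal ∂Θ + (∫ e, (u e).toReal ∂Θ - 1)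
        + (∫ e, (v e).toReal ∂Θ - 1) := by
      refine (integral_add (htint.add (hui.sub h1i)) (hvi.sub h1i)).trans ?_
      refine congrArg₂ (· + ·) ((integral_add htint (hui.sub h1i)).trans ?_)
        ((integral_sub hvi h1i).trans (by simp))
      exact congrArg₂ (· + ·) rfl ((integral_sub hui h1i).trans (by simp))
    have e2 : ∫ e, (u e).toReal ∂Θ ≤ 1 := by
      rw [integral_toReal hu.aemeasurable hu_top]
      exact ENNReal.toReal_le_of_le_ofReal zero_le_one (by simpa using hu1)
    have e3 : ∫ e, (v e).toReal ∂Θ ≤ 1 := by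
      rw [integral_toReal hv.aemeasurable hv_top]
      exact ENNReal.toReal_le_of_le_ofReal zero_le_one (by simpa using hv1)
    have e4 : ∫ e, Real.log (t e).toReal ∂Θ =
      (∫⁻ p, klDiv (K (p.1.W, p.1.X)) (K (p.2, p.1.X)) ∂Q).toReal := htD
    linarith
  have hB : Measurable fun ω : Outcome 𝓦 𝓧 𝓨 n => logLoss μ ω.Y (ψ ω.omniscient) :=
    hψ.comp (measurable_omniscient.prodMk measurable_snd.snd.snd)
  have hqm : Measurable fun b : (𝓧 × (Fin n → 𝓧 × 𝓨)) × 𝓨 => logLoss μ b.2 (q b.1) :=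
    continuous_neg.measurable.comp hq.ennreal_log
  have hA : Measurable fun ω : Outcome 𝓦 𝓧 𝓨 n => logLoss μ ω.Y (q ω.observed) :=
    hqm.comp (Outcome.measurable_observed.prodMk measurable_snd.snd.snd)
  have hm1 : Measurable fun e : (Outcome 𝓦 𝓧 𝓨 n × 𝓦) × 𝓨 => (resample e).1 :=
    measurable_fst.comp measurable_resample
  have hpw : ∀ᵐ e ∂Θ, logLoss μ (resample e).1.Y (q (resample e).1.observed) ≤
      logLoss μ (resample e).1.Y (ψ (resample e).1.omniscient) + f e := by
    filter_upwards [hrel, hu_top, hv_top] with e he hue hve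
    have hve' : p (a' e).1 (a' e).2 / (q (e.1.1.2.2.1, e.1.1.2.1)).1 e.2 ≠ ∞ := hve.ne
    change -ENNReal.log ((q (e.1.1.2.2.1, e.1.1.2.1)).1 e.2) ≤
      -ENNReal.log ((ψ (e.1.1.2.2.1, e.1.1.1)).1 e.2) + f e
    by_cases hNe : a e ∈ N
    -- On the singular part `p` is infinite at the sample too, so finiteness of `p/q` forces `q =
    -- ∞`: the learner's loss is `-∞`.
    · have hpt : p (a' e).1 (a' e).2 = ∞ := hNp _ _ (he.1 hNe)
      have hqt : (q (e.1.1.2.2.1, e.1.1.2.1)).1 e.2 = ∞ := by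
        by_contra h
        exact hve' (by rw [hpt, ENNReal.top_div_of_ne_top h])
      rw [hqt]
      simp
    · obtain ⟨h1, h2, h3, h4, h5⟩ := he.2 hNe
      have hue' : u e = (ψ (e.1.1.2.2.1, e.1.1.1)).1 e.2 / k (a e).1 (a e).2 :=
        Set.indicator_of_mem (s := Nᶜ) hNe _
      have := neg_log_le_add (s := (ψ (e.1.1.2.2.1, e.1.1.1)).1 e.2) h1 h2 h3 h4 h5
        (hkp _ _) (by rw [← hue']; exact hue.ne) hve'
      rw [← hue'] at this
      exact this
  have hBfin : ∫⁻ e, (logLoss μ (resample e).1.Y (ψ (resample e).1.omniscient)).toENNReal ∂Θ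
      ≠ ∞ := by
    rwa [← lintegral_map hB.ereal_toENNReal hm1, hΘP]
  obtain ⟨hAfin, hle⟩ := expectation_le_add (hA.comp hm1) (hB.comp hm1) hf hpw hBfin
  rw [← expectation_map hm1 hA, ← expectation_map hm1 hB, hΘP] at hle
  have hAdef : ExpectationDefined P fun ω => logLoss μ ω.Y (q ω.observed) := by
    left
    rw [← hΘP, lintegral_map hA.ereal_toENNReal hm1]
    exact hAfin
  refine ((iInf_le _ q).trans ((iInf_le _ hqm).trans (iInf_le _ hAdef))).trans
    (hle.trans (add_le_add le_rfl ?_))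
  rw [← EReal.coe_toReal (x := ((∫⁻ p, klDiv (K (p.1.W, p.1.X)) (K (p.2, p.1.X)) ∂Q : ℝ≥0∞) :
    EReal)) (by simpa using hD) (by simp), EReal.toReal_coe_ennreal]
  exact EReal.coe_le_coe_iff.mpr hfD

end BayesLearning

theorem mainTheorem9
    {𝓦 𝓧 𝓨 : Type*}
    [MeasurableSpace 𝓦] [StandardBorelSpace 𝓦] [Nonempty 𝓦]
    [MeasurableSpace 𝓧] [StandardBorelSpace 𝓧]
    [MeasurableSpace 𝓨] [StandardBorelSpace 𝓨]
    (n : ℕ)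
    (PW : Measure 𝓦) [IsProbabilityMeasure PW]
    (PX : Kernel 𝓦 𝓧) [IsMarkovKernel PX]
    (K : Kernel (𝓦 × 𝓧) 𝓨) [IsMarkovKernel K]
    (μ : Measure 𝓨) [SigmaFinite μ]
    (hMER : BayesLearning.MERDefined (BayesLearning.logLoss μ) n PW (PX ⊗ₖ K)) :
    BayesLearning.MER (BayesLearning.logLoss μ) n PW (PX ⊗ₖ K) ≤
      ((∫⁻ p, klDiv (K (p.1.W, p.1.X)) (K (p.2, p.1.X))
          ∂(BayesLearning.posteriorSampleLaw n PW (PX ⊗ₖ K)) : ℝ≥0∞) : EReal) := by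
  set D := ∫⁻ p, klDiv (K (p.1.W, p.1.X)) (K (p.2, p.1.X))
    ∂(BayesLearning.posteriorSampleLaw n PW (PX ⊗ₖ K))
  rcases eq_or_ne D ∞ with hD | hD
  · rw [hD]; exact le_top
  have hDt : (D : EReal) ≠ ⊤ := by simpa using hD
  have : IsMarkovKernel (BayesLearning.posteriorKernel n PW (PX ⊗ₖ K)) := by
    unfold BayesLearning.posteriorKernel; infer_instance
  unfold BayesLearning.MER
  -- Finiteness of `D` allows moving it to the left, leaving the omniscient infimum alone on the
  -- right, so one rule `ψ` can be treated at a time.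
  rw [EReal.sub_le_iff_le_add (.inr hDt) (.inr (by simp)), add_comm,
    ← EReal.sub_le_iff_le_add (.inl (by simp)) (.inl hDt)]
  refine le_iInf fun ψ => le_iInf fun hψ => le_iInf fun hdef => ?_
  rw [EReal.sub_le_iff_le_add (.inl (by simp)) (.inl hDt)]
  by_cases hpos : ∫⁻ ω : BayesLearning.Outcome 𝓦 𝓧 𝓨 n,
      (BayesLearning.logLoss μ ω.Y (ψ ω.omniscient)).toENNReal
      ∂BayesLearning.jointLaw n PW (PX ⊗ₖ K) = ∞
  -- A rule whose loss has infinite positive part has expected loss `+∞`, and the bound is trivial.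
  · have hneg := hdef.resolve_left (not_not.mpr hpos)
    unfold BayesLearning.expectation
    rw [hpos, EReal.coe_ennreal_top, EReal.top_sub (by simpa using hneg),
      EReal.top_add_of_ne_bot (by simp)]
    exact le_top
  · exact BayesLearning.learningRisk_logLoss_le_add
      (BayesLearning.posteriorKernel n PW (PX ⊗ₖ K)) μ ψ hψ hpos hD
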